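/- Let $n\ge 1$ and $k_1,\dots,k_n\ge 1$ be integers, let $M_k$ denote the space of complex $k\times k$ matrices, and identify $M_{k_1}\otimes\cdots\otimes M_{k_n}$ with $M_{k_1\cdots k_n}$ via the Kronecker product. The tensor rank of $A\in M_{k_1}\otimes\cdots\otimes M_{k_n}$ is the minimal number $r$ of nonzero elementary tensors $A_1\otimes\cdots\otimes A_n$ (with $A_i\in M_{k_i}$) whose sum is $A$ (so $0$ has tensor rank $0$). If $A\in M_{k_1}\otimes\cdots\otimes M_{k_n}$ is a positive semidefinite Hermitian matrix of tensor rank at most $2$, then $A$ is separable, that is, there are finitely many families $(C^{(j)}_1,\dots,C^{(j)}_n)$, $1\le j\le m$, of positive semidefinite Hermitian matrices $C^{(j)}_i\in M_{k_i}$ such that $$A=\sum_{j=1}^m C^{(j)}_1\otimes\cdots\otimes C^{(j)}_n .$$ -/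

import Mathlib

open scoped TensorProduct ComplexOrder

/-- The tensor rank of `t ∈ V₁ ⊗ ⋯ ⊗ Vₙ`: the least number of tensors of rank one, that is, nonzero
elementary tensors `v₁ ⊗ ⋯ ⊗ vₙ`, whose sum is `t` (so the zero tensor has rank `0`; the value
would be `⊤` if no such sum existed). -/
noncomputable def tensorRank {K : Type*} [Field K] {n : ℕ} {V : Fin n → Type*}
    [∀ i, AddCommGroup (V i)] [∀ i, Module K (V i)] (t : ⨂[K] i, V i) : ℕ∞ :=
  sInf {m : ℕ∞ | ∃ (r : ℕ) (v : Fin r → ∀ i, V i), m = r ∧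
    (∀ j, PiTensorProduct.tprod K (v j) ≠ 0) ∧ t = ∑ j, PiTensorProduct.tprod K (v j)}

/-- The tensor product `M_{k₁} ⊗ ⋯ ⊗ M_{kₙ}` of complex matrix spaces. -/
abbrev MatrixTensor {n : ℕ} (k : Fin n → ℕ) : Type :=
  ⨂[ℂ] i, Matrix (Fin (k i)) (Fin (k i)) ℂ

/-- The Kronecker product of `A₁, …, Aₙ`, with rows and columns indexed by multi-indices:
its entry at `(x, y)` is `∏ i, Aᵢ (xᵢ, yᵢ)`. -/
def multiKronecker {n : ℕ} (k : Fin n → ℕ) : MultilinearMap ℂ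
    (fun i => Matrix (Fin (k i)) (Fin (k i)) ℂ)
    (Matrix (∀ i, Fin (k i)) (∀ i, Fin (k i)) ℂ) where
  toFun A := Matrix.of fun x y => ∏ i, A i (x i) (y i)
  map_update_add' A i B C := by
    ext x y
    have h : ∀ D : Matrix (Fin (k i)) (Fin (k i)) ℂ,
        ∏ j, Function.update A i D j (x j) (y j)
          = D (x i) (y i) * ∏ j ∈ Finset.univ.erase i, A j (x j) (y j) := by
      intro D
      rw [← Finset.mul_prod_erase _ _ (Finset.mem_univ i), Function.update_self]
      congr 1
      refine Finset.prod_congr rfl fun j hj => ?_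
      rw [Function.update_of_ne (Finset.ne_of_mem_erase hj)]
    simp only [Matrix.of_apply, Matrix.add_apply, h, add_mul]
  map_update_smul' A i c B := by
    ext x y
    have h : ∀ D : Matrix (Fin (k i)) (Fin (k i)) ℂ,
        ∏ j, Function.update A i D j (x j) (y j)
          = D (x i) (y i) * ∏ j ∈ Finset.univ.erase i, A j (x j) (y j) := by
      intro D
      rw [← Finset.mul_prod_erase _ _ (Finset.mem_univ i), Function.update_self]
      congr 1
      refine Finset.prod_congr rfl fun j hj => ?_
      rw [Function.update_of_ne (Finset.ne_of_mem_erase hj)]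
    simp only [Matrix.of_apply, Matrix.smul_apply, h, smul_eq_mul, mul_assoc]

/-- The identification of `M_{k₁} ⊗ ⋯ ⊗ M_{kₙ}` with the square matrices of order `k₁ ⋯ kₙ` via the
Kronecker product: the linear map with `A₁ ⊗ ⋯ ⊗ Aₙ ↦` Kronecker product of the `Aᵢ`. -/
noncomputable def MatrixTensor.toMatrix {n : ℕ} (k : Fin n → ℕ) : MatrixTensor k →ₗ[ℂ]
    Matrix (∀ i, Fin (k i)) (∀ i, Fin (k i)) ℂ :=
  PiTensorProduct.lift (multiKronecker k)

/-- The identification via the Kronecker product is a bijection. -/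
theorem MatrixTensor.toMatrix_bijective {n : ℕ} (k : Fin n → ℕ) :
    Function.Bijective (MatrixTensor.toMatrix k) := by
  classical
  let b := Basis.piTensorProduct (fun i => Matrix.stdBasis ℂ (Fin (k i)) (Fin (k i)))
  let e : (∀ i, Fin (k i) × Fin (k i)) ≃ (∀ i, Fin (k i)) × (∀ i, Fin (k i)) :=
    Equiv.arrowProdEquivProdArrow _ _ _
  let f := b.equiv (Matrix.stdBasis ℂ (∀ i, Fin (k i)) (∀ i, Fin (k i))) e
  have h : MatrixTensor.toMatrix k = f.toLinearMap := by
    refine b.ext fun p => ?_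
    rw [LinearEquiv.coe_coe, Module.Basis.equiv_apply, Basis.piTensorProduct_apply,
      MatrixTensor.toMatrix, PiTensorProduct.lift.tprod]
    ext x y
    have he : e p = (fun i => (p i).1, fun i => (p i).2) := rfl
    rw [he, Matrix.stdBasis_eq_single]
    simp only [multiKronecker, MultilinearMap.coe_mk, Matrix.of_apply]
    have hi : ∀ i, (Matrix.stdBasis ℂ (Fin (k i)) (Fin (k i))) (p i)
        = Matrix.single (p i).1 (p i).2 1 := fun i => Matrix.stdBasis_eq_single ℂ (p i).1 (p i).2
    simp only [hi, Matrix.single_apply, Finset.prod_ite_zero, Finset.prod_const_one]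
    congr 1
    simp [funext_iff, forall_and]
  rw [h]
  exact f.bijective

/-- `A ∈ M_{k₁} ⊗ ⋯ ⊗ M_{kₙ}` is a positive semidefinite Hermitian matrix. -/
def MatrixTensor.IsPosSemidef {n : ℕ} {k : Fin n → ℕ} (A : MatrixTensor k) : Prop :=
  (MatrixTensor.toMatrix k A).PosSemidef

/-- `A ∈ M_{k₁} ⊗ ⋯ ⊗ M_{kₙ}` is separable: it is a finite sum of tensors `C₁ ⊗ ⋯ ⊗ Cₙ` with every
`Cᵢ ∈ M_{kᵢ}` positive semidefinite Hermitian. -/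
def MatrixTensor.IsSeparable {n : ℕ} {k : Fin n → ℕ} (A : MatrixTensor k) : Prop :=
  ∃ (r : ℕ) (C : Fin r → ∀ i, Matrix (Fin (k i)) (Fin (k i)) ℂ),
    (∀ j i, (C j i).PosSemidef) ∧ A = ∑ j, PiTensorProduct.tprod ℂ (C j)

/-! Contracting `A` against product vectors in all factors except the `i`-th yields positive
semidefinite matrices, and these span a space of dimension at most the tensor rank of `A`, hence at
most two. Two positive semidefinite matrices are simultaneously diagonalizable by congruence, so
each of these spans is fixed pointwise by a linear map `X ↦ ∑ a, (uₐ* X uₐ) Eₐ` with positive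
semidefinite `Eₐ`. Product functionals separate tensors, so the tensor product of these maps fixes
`A`. Expanding it writes `A` as a combination of tensor products of the matrices `Eₐ`, whose
coefficients `u* A u`, for product vectors `u`, are nonnegative. -/

section QuadForm

open Matrix

variable {m : Type*} [Fintype m]

/-- The quadratic form `X ↦ w* X w` at a vector `w`, as a linear functional of the matrix `X`. These
functionals test positivity and span the dual of the matrix space. -/
def quadForm (w : m → ℂ) : Module.Dual ℂ (Matrix m m ℂ) where
  toFun X := star w ⬝ᵥ X *ᵥ w
  map_add' X Y := by rw [add_mulVec, dotProduct_add]
  map_smul' c X := by rw [smul_mulVec, dotProduct_smul, RingHom.id_apply]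

theorem quadForm_apply (w : m → ℂ) (X : Matrix m m ℂ) : quadForm w X = star w ⬝ᵥ X *ᵥ w := rfl

theorem quadForm_conjTranspose (w : m → ℂ) (X : Matrix m m ℂ) :
    quadForm w Xᴴ = star (quadForm w X) := by
  rw [quadForm_apply, quadForm_apply, dotProduct_mulVec, ← star_mulVec, star_dotProduct,
    dotProduct_comm]

theorem eq_zero_of_quadForm_eq_zero {X : Matrix m m ℂ} (h : ∀ w, quadForm w X = 0) : X = 0 := by
  classical
  rw [← toEuclideanLin.map_eq_zero_iff, ← inner_map_self_eq_zero]
  intro w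
  have hw : inner ℂ w (toEuclideanLin X w) = quadForm w.ofLp X := by
    rw [EuclideanSpace.inner_eq_star_dotProduct, dotProduct_comm, quadForm_apply]
    rfl
  rw [← inner_conj_symm, hw, h, map_zero]

theorem span_range_quadForm :
    Submodule.span ℂ (Set.range (quadForm : (m → ℂ) → Module.Dual ℂ (Matrix m m ℂ))) = ⊤ := by
  refine Submodule.span_eq_top_of_ne_zero fun X hX => ?_
  by_contra! h
  exact hX (eq_zero_of_quadForm_eq_zero fun w => h _ ⟨w, rfl⟩)

theorem posSemidef_iff_quadForm_nonneg {X : Matrix m m ℂ} :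
    X.PosSemidef ↔ ∀ w, 0 ≤ quadForm w X := by
  refine ⟨fun hX w => hX.dotProduct_mulVec_nonneg w, fun h => ?_⟩
  refine .of_dotProduct_mulVec_nonneg (sub_eq_zero.1 ?_) h
  refine eq_zero_of_quadForm_eq_zero fun w => ?_
  rw [map_sub, quadForm_conjTranspose, (IsSelfAdjoint.of_nonneg (h w)).star_eq, sub_self]

end QuadForm

section SimultaneousDiagonalization

open Matrix

variable {m : Type*} [Fintype m] {𝕜 : Type*} [RCLike 𝕜]

theorem exists_eq_mul_diagonal_eigenvalues_mul_conjTranspose [DecidableEq m] {S : Matrix m m 𝕜}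
    (hS : S.IsHermitian) :
    ∃ U : Matrix m m 𝕜, Uᴴ * U = 1 ∧ U * Uᴴ = 1 ∧
      S = U * diagonal (fun i => (hS.eigenvalues i : 𝕜)) * Uᴴ := by
  refine ⟨hS.eigenvectorUnitary, Unitary.coe_star_mul_self _, Unitary.coe_mul_star_self _, ?_⟩
  have := hS.spectral_theorem
  rwa [Unitary.conjStarAlgAut_apply] at this

theorem exists_leftInvertible_eq_mul_conjTranspose [DecidableEq m] {S : Matrix m m 𝕜}
    (hS : S.PosSemidef) :
    ∃ (s : Finset m) (L : Matrix m s 𝕜) (M : Matrix s m 𝕜), M * L = 1 ∧ S = L * Lᴴ := by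
  obtain ⟨U, hU, -, hSU⟩ := exists_eq_mul_diagonal_eigenvalues_mul_conjTranspose hS.isHermitian
  let d (i : m) : 𝕜 := (√(hS.isHermitian.eigenvalues i) : ℝ)
  have hd (i) : d i * star (d i) = hS.isHermitian.eigenvalues i := by
    rw [RCLike.star_def, RCLike.conj_ofReal, ← RCLike.ofReal_mul,
      Real.mul_self_sqrt (hS.eigenvalues_nonneg i)]
  let s := Finset.univ.filter fun i => d i ≠ 0
  refine ⟨s, (U * diagonal d).submatrix id (↑), (diagonal d⁻¹ * Uᴴ).submatrix (↑) id, ?_, ?_⟩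
  · have hone : diagonal d⁻¹ * Uᴴ * (U * diagonal d) = diagonal fun i => (d i)⁻¹ * d i := by
      rw [Matrix.mul_assoc, ← Matrix.mul_assoc Uᴴ, hU, Matrix.one_mul, diagonal_mul_diagonal]
      rfl
    rw [← submatrix_mul _ _ _ _ _ Function.bijective_id, hone,
      submatrix_diagonal _ _ Subtype.val_injective, ← diagonal_one]
    congr with a
    exact inv_mul_cancel₀ (Finset.mem_filter.1 a.2).2
  · have hfull : S = U * diagonal d * (U * diagonal d)ᴴ := by
      rw [conjTranspose_mul, diagonal_conjTranspose, Matrix.mul_assoc, ← Matrix.mul_assoc _ _ Uᴴ,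
        diagonal_mul_diagonal, ← Matrix.mul_assoc]
      simpa only [Pi.star_apply, hd] using hSU
    ext x y
    rw [hfull, mul_apply, mul_apply, ← Finset.sum_subset s.subset_univ, ← Finset.sum_coe_sort s]
    · rfl
    · intro i _ hi
      have : d i = 0 := by simpa [s] using hi
      simp [this]

theorem mul_eq_zero_of_add_mul_eq_zero {n : Type*} {P Q : Matrix m m 𝕜} (hP : P.PosSemidef)
    (hQ : Q.PosSemidef) {K : Matrix m n 𝕜} (h : (P + Q) * K = 0) : P * K = 0 := by
  refine Matrix.ext_col fun j => ?_
  have hcol : (P + Q) *ᵥ K.col j = 0 := congr_arg (fun X : Matrix m n 𝕜 => X.col j) h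
  have hsum : star (K.col j) ⬝ᵥ P *ᵥ K.col j + star (K.col j) ⬝ᵥ Q *ᵥ K.col j = 0 := by
    rw [← dotProduct_add, ← add_mulVec, hcol, dotProduct_zero]
  have hzero := (add_eq_zero_iff_of_nonneg (hP.dotProduct_mulVec_nonneg _)
    (hQ.dotProduct_mulVec_nonneg _)).1 hsum
  exact (hP.dotProduct_mulVec_zero_iff _).1 hzero.1

theorem eq_mul_compress_mul_conjTranspose {s : Type*} [Fintype s] [DecidableEq s]
    {P Q : Matrix m m 𝕜} (hP : P.PosSemidef) (hQ : Q.PosSemidef) {L : Matrix m s 𝕜}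
    {M : Matrix s m 𝕜} (hML : M * L = 1) (hPQ : P + Q = L * Lᴴ) :
    P = L * (M * P * Mᴴ) * Lᴴ := by
  classical
  have hLM : Lᴴ * Mᴴ = 1 := by rw [← conjTranspose_mul, hML, conjTranspose_one]
  have hker : P * (1 - Mᴴ * Lᴴ) = 0 := by
    refine mul_eq_zero_of_add_mul_eq_zero hP hQ ?_
    rw [hPQ, Matrix.mul_assoc, Matrix.mul_sub, ← Matrix.mul_assoc, hLM, Matrix.one_mul,
      Matrix.mul_one, sub_self, Matrix.mul_zero]
  have hright : P = P * (Mᴴ * Lᴴ) := by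
    rwa [Matrix.mul_sub, Matrix.mul_one, sub_eq_zero] at hker
  have hleft : P = L * M * P := by
    simpa only [conjTranspose_mul, conjTranspose_conjTranspose, hP.1.eq] using
      congr_arg conjTranspose hright
  calc P = L * M * (P * (Mᴴ * Lᴴ)) := by rw [← hright, ← hleft]
    _ = L * (M * P * Mᴴ) * Lᴴ := by simp only [Matrix.mul_assoc]

theorem exists_simultaneous_diagonalization [DecidableEq m] {P Q : Matrix m m 𝕜}
    (hP : P.PosSemidef) (hQ : Q.PosSemidef) :
    ∃ (s : Finset m) (L : Matrix m s 𝕜) (M : Matrix s m 𝕜) (p q : s → 𝕜),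
      M * L = 1 ∧ P = L * diagonal p * Lᴴ ∧ Q = L * diagonal q * Lᴴ := by
  obtain ⟨s, L, M, hML, hPQ⟩ := exists_leftInvertible_eq_mul_conjTranspose (hP.add hQ)
  have hH : (M * P * Mᴴ).IsHermitian := (hP.mul_mul_conjTranspose_same M).isHermitian
  obtain ⟨V, hV, hV', hdiag⟩ := exists_eq_mul_diagonal_eigenvalues_mul_conjTranspose hH
  set p : s → 𝕜 := fun a => hH.eigenvalues a
  have hPL : P = L * V * diagonal p * (L * V)ᴴ := by
    calc P = L * (V * diagonal p * Vᴴ) * Lᴴ := by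
          rw [← hdiag, ← eq_mul_compress_mul_conjTranspose hP hQ hML hPQ]
      _ = L * V * diagonal p * (L * V)ᴴ := by simp only [conjTranspose_mul, Matrix.mul_assoc]
  refine ⟨s, L * V, Vᴴ * M, p, 1 - p, ?_, hPL, ?_⟩
  · rw [Matrix.mul_assoc, ← Matrix.mul_assoc M, hML, Matrix.one_mul, hV]
  · calc Q = L * Lᴴ - P := (sub_eq_of_eq_add' hPQ.symm).symm
      _ = L * V * (1 : Matrix s s 𝕜) * (L * V)ᴴ - L * V * diagonal p * (L * V)ᴴ := by
        rw [← hPL, Matrix.mul_one, conjTranspose_mul, Matrix.mul_assoc L, ← Matrix.mul_assoc V,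
          hV', Matrix.one_mul]
      _ = L * V * diagonal (1 - p) * (L * V)ᴴ := by
        rw [← Matrix.sub_mul, ← Matrix.mul_sub, ← diagonal_one, diagonal_sub]
        rfl

end SimultaneousDiagonalization

section MeasurePrepare

open Matrix

variable {m s : Type*} [Fintype s]

theorem mul_diagonal_mul_conjTranspose_eq_sum {R : Type*} [CommSemiring R] [Star R]
    [DecidableEq s] (L : Matrix m s R) (d : s → R) :
    L * diagonal d * Lᴴ = ∑ a, d a • vecMulVec (L.col a) (star (L.col a)) := by
  ext x y
  rw [mul_apply]
  simp only [mul_diagonal, conjTranspose_apply, Matrix.sum_apply, Matrix.smul_apply,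
    vecMulVec_apply, Pi.star_apply, col_apply, smul_eq_mul]
  exact Finset.sum_congr rfl fun a _ => by rw [mul_comm (L x a), mul_assoc]

variable [Fintype m]

/-- The linear map `X ↦ ∑ a, (uₐ* X uₐ) Eₐ`, a measure-and-prepare (entanglement-breaking) map if
all `Eₐ` are positive semidefinite. Tensor products of such maps have only separable values on
positive semidefinite tensors. -/
def measurePrepare (u : s → m → ℂ) (E : s → Matrix m m ℂ) : Matrix m m ℂ →ₗ[ℂ] Matrix m m ℂ :=
  ∑ a, (quadForm (u a)).smulRight (E a)

theorem measurePrepare_apply (u : s → m → ℂ) (E : s → Matrix m m ℂ) (X : Matrix m m ℂ) :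
    measurePrepare u E X = ∑ a, quadForm (u a) X • E a := by
  simp [measurePrepare]

theorem quadForm_mul_diagonal_mul_conjTranspose [DecidableEq s] {L : Matrix m s ℂ}
    {M : Matrix s m ℂ} (hML : M * L = 1) (d : s → ℂ) (a : s) :
    quadForm (star (M a)) (L * diagonal d * Lᴴ) = d a := by
  have hLM : Lᴴ * Mᴴ = 1 := by rw [← conjTranspose_mul, hML, conjTranspose_one]
  calc quadForm (star (M a)) (L * diagonal d * Lᴴ)
      = (M * (L * diagonal d * Lᴴ * Mᴴ)) a a := by rw [quadForm_apply, star_star]; rfl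
    _ = ((M * L) * diagonal d * (Lᴴ * Mᴴ)) a a := by simp only [Matrix.mul_assoc]
    _ = d a := by rw [hML, hLM, Matrix.one_mul, Matrix.mul_one, diagonal_apply_eq]

theorem measurePrepare_mul_diagonal_mul_conjTranspose [DecidableEq s] {L : Matrix m s ℂ}
    {M : Matrix s m ℂ} (hML : M * L = 1) (d : s → ℂ) :
    measurePrepare (fun a => star (M a)) (fun a => vecMulVec (L.col a) (star (L.col a)))
      (L * diagonal d * Lᴴ) = L * diagonal d * Lᴴ := by
  simp only [measurePrepare_apply, quadForm_mul_diagonal_mul_conjTranspose hML]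
  exact (mul_diagonal_mul_conjTranspose_eq_sum L d).symm

theorem exists_measurePrepare_eq_self {P Q : Matrix m m ℂ} (hP : P.PosSemidef)
    (hQ : Q.PosSemidef) :
    ∃ (s : Finset m) (u : s → m → ℂ) (E : s → Matrix m m ℂ), (∀ a, (E a).PosSemidef) ∧
      ∀ X ∈ Submodule.span ℂ {P, Q}, measurePrepare u E X = X := by
  classical
  obtain ⟨s, L, M, p, q, hML, rfl, rfl⟩ := exists_simultaneous_diagonalization hP hQ
  refine ⟨s, fun a => star (M a), fun a => vecMulVec (L.col a) (star (L.col a)),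
    fun a => posSemidef_vecMulVec_self_star (L.col a), fun X hX => ?_⟩
  refine LinearMap.eqOn_span (g := LinearMap.id) ?_ hX
  rintro _ (rfl | rfl) <;> exact measurePrepare_mul_diagonal_mul_conjTranspose hML _

end MeasurePrepare

theorem exists_subset_span_pair_of_finrank_span_le_two {K V : Type*} [DivisionRing K]
    [AddCommGroup V] [Module K V] {T : Set V} (hT : T.Nonempty)
    [Module.Finite K (Submodule.span K T)] (h : Module.finrank K (Submodule.span K T) ≤ 2) :
    ∃ x ∈ T, ∃ y ∈ T, T ⊆ Submodule.span K {x, y} := by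
  obtain ⟨b, hbT, hcard, hspan, -⟩ := Submodule.exists_finset_span_eq_linearIndepOn K T
  have hsub : T ⊆ Submodule.span K (b : Set V) := hspan ▸ Submodule.subset_span
  obtain hb | hb | hb : b.card = 0 ∨ b.card = 1 ∨ b.card = 2 := by lia
  · obtain ⟨x, hx⟩ := hT
    refine ⟨x, hx, x, hx, hsub.trans (Submodule.span_mono ?_)⟩
    simp [Finset.card_eq_zero.1 hb]
  · obtain ⟨x, rfl⟩ := Finset.card_eq_one.1 hb
    exact ⟨x, hbT (by simp), x, hbT (by simp), by simpa using hsub⟩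
  · classical
    obtain ⟨x, y, -, rfl⟩ := Finset.card_eq_two.1 hb
    exact ⟨x, hbT (by simp), y, hbT (by simp), by simpa using hsub⟩

section TensorDuality

open Module PiTensorProduct

variable {ι R : Type*} {V : ι → Type*} [CommSemiring R] [∀ i, AddCommMonoid (V i)]
  [∀ i, Module R (V i)]

/-- The value `(f₁ ⊗ ⋯ ⊗ fₙ) t` of a product functional on a fixed tensor `t`, as a multilinear
map of the functionals `fᵢ` on the factors. -/
noncomputable def productPairing [Finite ι] (t : ⨂[R] i, V i) :
    MultilinearMap R (fun i => Dual R (V i)) R :=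
  (LinearMap.applyₗ t ∘ₗ dualDistrib).compMultilinearMap (tprod R)

theorem productPairing_apply [Finite ι] (t : ⨂[R] i, V i) (f : ∀ i, Dual R (V i)) :
    productPairing t f = dualDistrib (tprod R f) t := rfl

theorem productPairing_map [Finite ι] (p : ∀ i, V i →ₗ[R] V i) (t : ⨂[R] i, V i)
    (f : ∀ i, Dual R (V i)) :
    productPairing (PiTensorProduct.map p t) f = productPairing t fun i => f i ∘ₗ p i := by
  have := Fintype.ofFinite ι
  suffices dualDistrib (tprod R f) ∘ₗ PiTensorProduct.map p
      = dualDistrib (tprod R fun i => f i ∘ₗ p i) from LinearMap.congr_fun this t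
  ext v
  simp

theorem map_sum_smulRight [Fintype ι] [DecidableEq ι] {σ : ι → Type*} [∀ i, Fintype (σ i)]
    (f : ∀ i, σ i → Dual R (V i)) (e : ∀ i, σ i → V i) (t : ⨂[R] i, V i) :
    PiTensorProduct.map (fun i => ∑ a, (f i a).smulRight (e i a)) t
      = ∑ b : ∀ i, σ i, productPairing t (fun i => f i (b i)) • tprod R fun i => e i (b i) := by
  suffices PiTensorProduct.map (fun i => ∑ a, (f i a).smulRight (e i a))
      = ∑ b : ∀ i, σ i, (dualDistrib (tprod R fun i => f i (b i))).smulRight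
          (tprod R fun i => e i (b i)) by
    simp [this, productPairing_apply]
  ext v
  simp [MultilinearMap.map_sum, MultilinearMap.map_smul_univ]

variable [∀ i, Module.Free R (V i)]

theorem eq_of_productPairing_eq [Finite ι] {γ : ι → Type*} {g : ∀ ⦃i⦄, γ i → Dual R (V i)}
    (hg : ∀ i, Submodule.span R (Set.range (@g i)) = ⊤) {t t' : ⨂[R] i, V i}
    (h : ∀ w : ∀ i, γ i, productPairing t (fun i => g (w i)) = productPairing t' fun i => g (w i)) :
    t = t' := by
  have := Fintype.ofFinite ι
  have heq : LinearMap.applyₗ t ∘ₗ dualDistrib = LinearMap.applyₗ t' ∘ₗ dualDistrib :=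
    ext_of_span_eq_top hg h
  let b (i : ι) : Basis (Free.ChooseBasisIndex R (V i)) R (V i) := Free.chooseBasis R (V i)
  refine (Basis.piTensorProduct b).ext_elem fun p => ?_
  have hcoord : (Basis.piTensorProduct b).coord p
      = dualDistrib (tprod R fun i => (b i).coord (p i)) := by
    ext v
    simp
  rw [← Basis.coord_apply, ← Basis.coord_apply, hcoord]
  exact LinearMap.congr_fun heq _

variable [∀ i, Module.Finite R (V i)] [DecidableEq ι]

/-- The contraction of a tensor `t` with the functionals `f l` in all factors `l ≠ i`, an element of
the factor `i`. It is defined through its values under functionals on that factor; `f i` is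
ignored. -/
noncomputable def contraction [Finite ι] (t : ⨂[R] i, V i) (i : ι) (f : ∀ i, Dual R (V i)) : V i :=
  (evalEquiv R (V i)).symm ((productPairing t).toLinearMap f i)

theorem apply_contraction [Finite ι] (t : ⨂[R] i, V i) (i : ι) (f : ∀ i, Dual R (V i))
    (g : Dual R (V i)) :
    g (contraction t i f) = productPairing t (Function.update f i g) :=
  apply_evalEquiv_symm_apply _ _ _ _

theorem contraction_sum_tprod_mem_span [Finite ι] {J : Type*} [Fintype J] (v : J → ∀ i, V i) (i : ι)
    (f : ∀ i, Dual R (V i)) :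
    contraction (∑ j, tprod R (v j)) i f ∈ Submodule.span R (Set.range fun j => v j i) := by
  have := Fintype.ofFinite ι
  have hsum : contraction (∑ j, tprod R (v j)) i f
      = ∑ j, (∏ l ∈ Finset.univ.erase i, f l (v j l)) • v j i := by
    refine eval_apply_injective R (LinearMap.ext fun g => ?_)
    rw [Dual.eval_apply, Dual.eval_apply, apply_contraction, productPairing_apply, map_sum, map_sum]
    refine Finset.sum_congr rfl fun j _ => ?_
    rw [dualDistrib_apply, ← Finset.prod_erase_mul _ _ (Finset.mem_univ i), Function.update_self,
      map_smul, smul_eq_mul]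
    congr 1
    refine Finset.prod_congr rfl fun l hl => ?_
    rw [Function.update_of_ne (Finset.ne_of_mem_erase hl)]
  rw [hsum]
  exact sum_mem fun j _ => Submodule.smul_mem _ _ (Submodule.subset_span ⟨j, rfl⟩)

variable {γ : ι → Type*} {g : ∀ ⦃i⦄, γ i → Dual R (V i)}

theorem map_update_id_eq_self [Finite ι] (hg : ∀ i, Submodule.span R (Set.range (@g i)) = ⊤)
    {t : ⨂[R] i, V i} {i : ι} {p : V i →ₗ[R] V i}
    (hp : ∀ w : ∀ i, γ i, p (contraction t i fun l => g (w l)) = contraction t i fun l => g (w l)) :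
    PiTensorProduct.map (Function.update (fun _ => LinearMap.id) i p) t = t := by
  refine eq_of_productPairing_eq hg fun w => ?_
  calc productPairing (PiTensorProduct.map (Function.update (fun _ => LinearMap.id) i p) t)
        (fun l => g (w l))
      = productPairing t (Function.update (fun l => g (w l)) i (g (w i) ∘ₗ p)) := by
        rw [productPairing_map]
        congr 1 with l : 1
        obtain rfl | hl := eq_or_ne l i <;> simp [*]
    _ = g (w i) (p (contraction t i fun l => g (w l))) := (apply_contraction ..).symm
    _ = productPairing t fun l => g (w l) := by
        rw [hp, apply_contraction, Function.update_eq_self]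

theorem map_eq_self_of_contraction_fixed [Finite ι]
    (hg : ∀ i, Submodule.span R (Set.range (@g i)) = ⊤)
    {t : ⨂[R] i, V i} {p : ∀ i, V i →ₗ[R] V i}
    (hp : ∀ i (w : ∀ i, γ i),
      p i (contraction t i fun l => g (w l)) = contraction t i fun l => g (w l)) :
    PiTensorProduct.map p t = t := by
  have := Fintype.ofFinite ι
  suffices ∀ s : Finset ι, PiTensorProduct.map (s.piecewise p fun _ => LinearMap.id) t = t by
    simpa using this Finset.univ
  intro s
  induction s using Finset.induction_on with
  | empty => simp
  | insert a s ha ih =>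
    have hcomp : (insert a s).piecewise p (fun _ => LinearMap.id)
        = fun i => (Function.update (fun _ => LinearMap.id) a (p a) : ∀ i, V i →ₗ[R] V i) i ∘ₗ
          s.piecewise p (fun _ => LinearMap.id) i := by
      ext1 i
      obtain rfl | hi := eq_or_ne i a <;> simp [*]
    rw [hcomp, PiTensorProduct.map_comp, LinearMap.comp_apply, ih, map_update_id_eq_self hg (hp a)]

end TensorDuality

namespace MatrixTensor

open PiTensorProduct Matrix

variable {n : ℕ} {k : Fin n → ℕ} {A : MatrixTensor k}

theorem productPairing_quadForm (A : MatrixTensor k) (w : ∀ i, Fin (k i) → ℂ) :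
    productPairing A (fun i => quadForm (w i))
      = quadForm (fun x => ∏ i, w i (x i)) (toMatrix k A) := by
  suffices dualDistrib (tprod ℂ fun i => quadForm (w i))
      = quadForm (fun x => ∏ i, w i (x i)) ∘ₗ toMatrix k from LinearMap.congr_fun this A
  refine PiTensorProduct.ext (MultilinearMap.ext fun X => ?_)
  simp only [LinearMap.compMultilinearMap_apply, LinearMap.comp_apply, dualDistrib_apply, toMatrix,
    lift.tprod, quadForm_apply, dotProduct, mulVec, multiKronecker, MultilinearMap.coe_mk,
    Matrix.of_apply, Pi.star_apply, star_prod]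
  simp only [Finset.prod_univ_sum, Fintype.piFinset_univ, Finset.prod_mul_distrib]

/-- `A` is block-positive: `w* A w ≥ 0` for every product vector `w = w₁ ⊗ ⋯ ⊗ wₙ`. Over `ℂ` this
includes that these values are real, hence that `A` is Hermitian. -/
def IsBlockPositive (A : MatrixTensor k) : Prop :=
  ∀ w : ∀ i, Fin (k i) → ℂ, 0 ≤ quadForm (fun x => ∏ i, w i (x i)) (toMatrix k A)

theorem IsPosSemidef.isBlockPositive (hA : A.IsPosSemidef) : A.IsBlockPositive := fun _ =>
  posSemidef_iff_quadForm_nonneg.1 hA _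

theorem IsBlockPositive.productPairing_nonneg (hA : A.IsBlockPositive)
    (w : ∀ i, Fin (k i) → ℂ) : 0 ≤ productPairing A fun i => quadForm (w i) := by
  rw [productPairing_quadForm]
  exact hA w

theorem IsBlockPositive.posSemidef_contraction (hA : A.IsBlockPositive) (i : Fin n)
    (w : ∀ i, Fin (k i) → ℂ) : (contraction A i fun l => quadForm (w l)).PosSemidef := by
  refine posSemidef_iff_quadForm_nonneg.2 fun u => ?_
  have hupdate : Function.update (fun l => quadForm (w l)) i (quadForm u)
      = fun l => quadForm (Function.update w i u l) := by
    ext1 l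
    obtain rfl | hl := eq_or_ne l i <;> simp [*]
  rw [apply_contraction (t := A), hupdate]
  exact hA.productPairing_nonneg _

theorem isSeparable_sum_tprod {J : Type*} [Fintype J]
    {C : J → ∀ i, Matrix (Fin (k i)) (Fin (k i)) ℂ} (hC : ∀ j i, (C j i).PosSemidef) :
    IsSeparable (∑ j, tprod ℂ (C j)) :=
  ⟨Fintype.card J, fun j => C ((Fintype.equivFin J).symm j), fun _ => hC _,
    ((Fintype.equivFin J).symm.sum_comp fun j => tprod ℂ (C j)).symm⟩

theorem isSeparable_sum_smul_tprod [NeZero n] {J : Type*} [Fintype J] {c : J → ℂ}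
    (hc : ∀ j, 0 ≤ c j) {C : J → ∀ i, Matrix (Fin (k i)) (Fin (k i)) ℂ}
    (hC : ∀ j i, (C j i).PosSemidef) : IsSeparable (∑ j, c j • tprod ℂ (C j)) := by
  have habsorb (j : J) :
      c j • tprod ℂ (C j) = tprod ℂ (Function.update (C j) 0 (c j • C j 0)) := by
    rw [MultilinearMap.map_update_smul, Function.update_eq_self]
  simp only [habsorb]
  refine isSeparable_sum_tprod fun j i => ?_
  obtain rfl | hi := eq_or_ne i 0
  · simpa using (hC j 0).smul (hc j)
  · simpa [hi] using hC j i

theorem IsBlockPositive.isSeparable_of_contraction_mem_span_pair [NeZero n] (hA : A.IsBlockPositive)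
    (hspan : ∀ i, ∃ P Q : Matrix (Fin (k i)) (Fin (k i)) ℂ, P.PosSemidef ∧ Q.PosSemidef ∧
      ∀ w : ∀ i, Fin (k i) → ℂ,
        contraction A i (fun l => quadForm (w l)) ∈ Submodule.span ℂ {P, Q}) :
    A.IsSeparable := by
  choose P Q hP hQ hPQ using hspan
  choose s u E hE hfix using fun i => exists_measurePrepare_eq_self (hP i) (hQ i)
  have hA_fixed : PiTensorProduct.map (fun i => measurePrepare (u i) (E i)) A = A :=
    map_eq_self_of_contraction_fixed (fun _ => span_range_quadForm) fun i w => hfix i _ (hPQ i w)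
  have hcoeff_nonneg (b : ∀ i, s i) : 0 ≤ productPairing A fun i => quadForm (u i (b i)) :=
    hA.productPairing_nonneg fun i => u i (b i)
  have hA_expand := hA_fixed.symm.trans (map_sum_smulRight (fun i a => quadForm (u i a)) E A)
  rw [hA_expand]
  exact isSeparable_sum_smul_tprod hcoeff_nonneg fun b i => hE i (b i)

theorem IsBlockPositive.exists_contraction_mem_span_pair {r : ℕ}
    {v : Fin r → ∀ i, Matrix (Fin (k i)) (Fin (k i)) ℂ} (hA : IsBlockPositive (∑ j, tprod ℂ (v j)))
    (hr : r ≤ 2) (i : Fin n) :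
    ∃ P Q : Matrix (Fin (k i)) (Fin (k i)) ℂ, P.PosSemidef ∧ Q.PosSemidef ∧
      ∀ w : ∀ i, Fin (k i) → ℂ,
        contraction (∑ j, tprod ℂ (v j)) i (fun l => quadForm (w l)) ∈ Submodule.span ℂ {P, Q} := by
  let T := Set.range fun w : ∀ i, Fin (k i) → ℂ =>
    contraction (∑ j, tprod ℂ (v j)) i fun l => quadForm (w l)
  have hT : Submodule.span ℂ T ≤ Submodule.span ℂ (Set.range fun j => v j i) :=
    Submodule.span_le.2 <| Set.range_subset_iff.2 fun w => contraction_sum_tprod_mem_span v i _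
  have hdim : Module.finrank ℂ (Submodule.span ℂ T) ≤ 2 :=
    calc Module.finrank ℂ (Submodule.span ℂ T)
      _ ≤ Module.finrank ℂ (Submodule.span ℂ (Set.range fun j => v j i)) :=
        Submodule.finrank_mono hT
      _ ≤ r := (finrank_range_le_card fun j => v j i).trans_eq (Fintype.card_fin r)
      _ ≤ 2 := hr
  obtain ⟨_, ⟨x, rfl⟩, _, ⟨y, rfl⟩, hxy⟩ :=
    exists_subset_span_pair_of_finrank_span_le_two (Set.range_nonempty _) hdim
  exact ⟨_, _, hA.posSemidef_contraction i x, hA.posSemidef_contraction i y,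
    fun w => hxy ⟨w, rfl⟩⟩

end MatrixTensor

theorem exists_eq_sum_tprod_of_tensorRank_le {K : Type*} [Field K] {n : ℕ} {V : Fin n → Type*}
    [∀ i, AddCommGroup (V i)] [∀ i, Module K (V i)] {t : ⨂[K] i, V i} {m : ℕ}
    (h : tensorRank t ≤ m) :
    ∃ (r : ℕ) (v : Fin r → ∀ i, V i), r ≤ m ∧ t = ∑ j, PiTensorProduct.tprod K (v j) := by
  have hlt : tensorRank t < m + 1 := (ENat.lt_add_one_iff (ENat.natCast_ne_top m)).2 h
  obtain ⟨_, ⟨r, v, rfl, -, ht⟩, hr⟩ := sInf_lt_iff.1 hlt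
  exact ⟨r, v, by exact_mod_cast Order.le_of_lt_add_one hr, ht⟩

theorem mainTheorem12_general {n : ℕ} {k : Fin n → ℕ} {A : MatrixTensor k}
    (hA : A.IsBlockPositive) (hrank : tensorRank A ≤ 2) : A.IsSeparable := by
  obtain ⟨r, v, hr, rfl⟩ := exists_eq_sum_tprod_of_tensorRank_le (m := 2) hrank
  obtain _ | n := n
  · exact ⟨r, v, fun _ i => i.elim0, rfl⟩
  · exact hA.isSeparable_of_contraction_mem_span_pair (hA.exists_contraction_mem_span_pair hr)

theorem mainTheorem12 (n : ℕ) (k : Fin n → ℕ) (A : MatrixTensor k)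
    (hA : A.IsPosSemidef) (hrank : tensorRank A ≤ 2) : A.IsSeparable :=
  mainTheorem12_general hA.isBlockPositive hrank
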